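/- **Lemma 1.2.** Let $V$ be a countable set and let $J$ be a time-homogeneous Markov chain on $V$, either in discrete time ($\mathbb N_0$) or in continuous time ($[0,\infty)$) and non-explosive (right-continuous paths with finitely many jumps in bounded time intervals). Write $P_\mu$ for its law with initial distribution $\mu$ and $P_x=P_{\delta_x}$. Let $(a_n)$ be a non-decreasing sequence of positive real numbers, let $\theta_n>0$ (with $\theta_n\in\mathbb N$ in discrete time), and put $k_n(t)=\lfloor\lfloor a_nt\rfloor/\theta_n\rfloor$. For $t>0$, $c<\infty$ and $x\in V$ consider $$\lim_{n\to\infty}\sum_{k=1}^{k_n(t)-1}P_\mu(J(k\theta_n)=x)=0,\tag{a11}$$ $$\lim_{n\to\infty}\sum_{k=1}^{k_n(t)-1}P_x(J(k\theta_n)=x)<c.\tag{a12}$$ Condition (A-1) says that for every $t>0$ there is $c<\infty$ such that (a11) holds uniformly in $x\in V$ and (a12) holds, with this $c$, for all $x\in V$. A state $x$ is *transient* if $P_x$-almost surely $\{s: J(s)=x\}$ is bounded. It is *positive recurrent* if its mean return time under $P_x$ is finite or, in continuous time, if $x$ is absorbing; the return time is $\inf\{n\ge1:J(n)=x\}$ in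 discrete time, and the first time at which $J$ is in $x$ after having left $x$ in continuous time. A probability measure $\pi$ on $V$ is *invariant* if $\sum_x\pi(x)P_x(J(s)=y)=\pi(y)$ for all $s$ and $y$. (i) If $\theta_n\to\infty$, then for every $t>0$ there is $c<\infty$ such that (a11) and (a12) hold at every transient state $x$. (ii) Let $\theta_n/a_n\to0$, let $x$ be positive recurrent, and let $t>0$ be such that $a_nt\ge1$ for all large $n$ (which is automatic in discrete time, or if $a_n\to\infty$). Then the sum in (a12) tends to $+\infty$ as $n\to\infty$. In particular (a12) fails for every $c<\infty$, so that (a11) and (a12) cannot both be satisfied at $x$. (iii) If $\theta_n/a_n\to0$ and $J$ has an invariant probability measure, then (A-1) fails. -/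

import Mathlib

open Filter Topology MeasureTheory Asymptotics
open scoped NNReal ENNReal

namespace BlockedChain

section Chains

variable {T V Ω : Type*} [MeasurableSpace Ω]

/-- `J` is a time-homogeneous Markov chain with state space `V` and time set `T` (`ℕ` or `ℝ≥0`),
with law `P x` when it starts in `x`. The finite-dimensional distributions are given in terms of
the time increments `s 0, s 1, …`: for all states `y 0, …, y n`,
`P_{y 0}(J(s 0 + … + s (i-1)) = y i for i ≤ n) = ∏_{i < n} P_{y i}(J(s i) = y (i+1))`.
(For `n = 0` this says that `J 0 = y 0` almost surely under `P (y 0)`.) -/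
structure IsMarkovChain [AddCommMonoid T] (P : V → Measure Ω) (J : T → Ω → V) : Prop where
  isProbabilityMeasure : ∀ x, IsProbabilityMeasure (P x)
  measurableSet_eq : ∀ t y, MeasurableSet {ω | J t ω = y}
  markov : ∀ (n : ℕ) (s : ℕ → T) (y : ℕ → V),
    P (y 0) {ω | ∀ i ≤ n, J (∑ j ∈ Finset.range i, s j) ω = y i} =
      ∏ i ∈ Finset.range n, P (y i) {ω | J (s i) ω = y (i + 1)}

/-- A path in continuous time is a regular step function: it is right-continuous and has left limits
for the discrete topology of `V`. Equivalently it is right-continuous and makes finitely many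
jumps in every bounded time interval. -/
def IsStepPath (f : ℝ≥0 → V) : Prop :=
  (∀ t, ∀ᶠ s in 𝓝[>] t, f s = f t) ∧ (∀ t, ∃ y, ∀ᶠ s in 𝓝[<] t, f s = y)

/-- A non-explosive continuous time Markov chain. -/
structure IsNonexplosiveChain (P : V → Measure Ω) (J : ℝ≥0 → Ω → V) : Prop
    extends IsMarkovChain P J where
  step : ∀ x, ∀ᵐ ω ∂(P x), IsStepPath fun t => J t ω

/-- The law `P_μ = ∑_x μ(x) P_x` with initial distribution `μ`. -/
noncomputable def initLaw (P : V → Measure Ω) (μ : PMF V) : Measure Ω :=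
  Measure.sum fun x => μ x • P x

/-- The state `x` is transient: the chain started in `x` almost surely visits `x` only up to some
finite time. -/
def IsTransient [LE T] (P : V → Measure Ω) (J : T → Ω → V) (x : V) : Prop :=
  ∀ᵐ ω ∂(P x), BddAbove {t : T | J t ω = x}

/-- The probability measure `π` on `V` is invariant: `∑_x π(x) P_x(J(t) = y) = π(y)`. -/
def IsInvariantLaw (P : V → Measure Ω) (J : T → Ω → V) (π : PMF V) : Prop :=
  ∀ t y, ∑' x, π x * P x {ω | J t ω = y} = π y

/-- Discrete time: the first return time `inf {n ≥ 1 : J(n) = x}` to `x`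
(infinite if there is no return). -/
noncomputable def returnTimeD (J : ℕ → Ω → V) (x : V) (ω : Ω) : ℝ≥0∞ :=
  ⨅ (n : ℕ) (_ : 1 ≤ n ∧ J n ω = x), (n : ℝ≥0∞)

/-- Discrete time: `x` is positive recurrent, i.e. its mean return time is finite. -/
def IsPosRecurrentD (P : V → Measure Ω) (J : ℕ → Ω → V) (x : V) : Prop :=
  ∫⁻ ω, returnTimeD J x ω ∂(P x) < ∞

/-- Continuous time: the first time at which the chain is in `x` after having been
away from `x` (infinite if there is no such time). -/
noncomputable def returnTimeC (J : ℝ≥0 → Ω → V) (x : V) (ω : Ω) : ℝ≥0∞ :=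
  ⨅ (t : ℝ≥0) (_ : J t ω = x ∧ ∃ s < t, J s ω ≠ x), (t : ℝ≥0∞)

/-- Continuous time: `x` is positive recurrent, i.e. `x` is absorbing or its mean return time is
finite. -/
def IsPosRecurrentC (P : V → Measure Ω) (J : ℝ≥0 → Ω → V) (x : V) : Prop :=
  (∀ᵐ ω ∂(P x), ∀ t, J t ω = x) ∨ ∫⁻ ω, returnTimeC J x ω ∂(P x) < ∞

/-- The number of blocks `k_n(t) = ⌊⌊a_n t⌋ / θ_n⌋`. -/
noncomputable def blockCount (a θ : ℕ → ℝ) (n : ℕ) (t : ℝ) : ℕ :=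
  ⌊(⌊a n * t⌋₊ : ℝ) / θ n⌋₊

/-- The sum `∑_{j=1}^{k-1} Q(J(j θ) = x)`. -/
noncomputable def visitSum [AddCommMonoid T] (Q : Measure Ω) (J : T → Ω → V) (θ : T) (k : ℕ)
    (x : V) : ℝ :=
  ∑ j ∈ Finset.Ico 1 k, Q.real {ω | J (j • θ) ω = x}

/-- `lim_n u_n < c`: the limit exists and is smaller than `c`. -/
def LimLT (u : ℕ → ℝ) (c : ℝ) : Prop :=
  ∃ l < c, Tendsto u atTop (𝓝 l)

/-- The occupation sum condition at the state `x`, for fixed `t`: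
`lim_n ∑_{j=1}^{k_n(t)-1} P_μ(J(j θ_n) = x) = 0`. -/
def OccupationCond [AddCommMonoid T] (P : V → Measure Ω) (μ : PMF V) (J : T → Ω → V)
    (θ : ℕ → T) (k : ℕ → ℝ → ℕ) (t : ℝ) (x : V) : Prop :=
  Tendsto (fun n => visitSum (initLaw P μ) J (θ n) (k n t) x) atTop (𝓝 0)

/-- The return sum condition at the state `x`, for fixed `t` and `c`:
`lim_n ∑_{j=1}^{k_n(t)-1} P_x(J(j θ_n) = x) < c`. -/
def ReturnCond [AddCommMonoid T] (P : V → Measure Ω) (J : T → Ω → V)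
    (θ : ℕ → T) (k : ℕ → ℝ → ℕ) (t c : ℝ) (x : V) : Prop :=
  LimLT (fun n => visitSum (P x) J (θ n) (k n t) x) c

/-- The condition (A-1): for all `t > 0` there is a finite `c` such that, uniformly in `x`, the
occupation sums tend to `0` and the return sums have a limit smaller than `c`. -/
def CondA1 [AddCommMonoid T] (P : V → Measure Ω) (μ : PMF V) (J : T → Ω → V)
    (θ : ℕ → T) (k : ℕ → ℝ → ℕ) : Prop :=
  ∀ t > 0, ∃ c : ℝ,
    TendstoUniformly (fun n x => visitSum (initLaw P μ) J (θ n) (k n t) x) (fun _ => 0) atTop ∧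
    ∀ x, ReturnCond P J θ k t c x

end Chains

end BlockedChain

open BlockedChain

namespace BlockedChain

/-! Everything is read off two renewal decompositions on a time grid. Splitting at the first
entrance shows that the expected number of visits to `x` along a progression is largest for the
start in `x` (`IsMarkovChain.sum_measure_le`). Splitting at the last visit relates visit
probabilities to probabilities of avoiding `x` (`IsMarkovChain.sum_last_visit`).

Transient `x`: on a coarse grid the avoidance probabilities are at least 1/2, so the expected number
of visits is finite, and the sums in question are dominated by tails of a convergent series.

Positive recurrent `x`: the sum of the avoidance probabilities is controlled by the mean return
time, so visits along one fixed grid have positive frequency. Averaging a double sum over this grid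
and a grid of step `θ` carries a linear lower bound over to every `θ`, with the same rate
(`IsMarkovChain.mul_le_two_mul_sum_of_frequency`). Periodicity and limit theorems play no role. As
the number of blocks tends to infinity, the return sums diverge.

In continuous time the chain stays in `x` up to some `η > 0` with probability at least 1/2, so
moving a time by at most `η` costs a factor 2; the return time is reached through dyadic refinements
of the `η`-grid.

An invariant law `π` gives linear growth directly, at any `x` with `π x > 0` and with rate `π x`, by
the first-entrance bound. -/

/-! ### The Markov property for cylinder events -/

theorem measurableSet_mem_of_countable {V Ω : Type*} [Countable V] [MeasurableSpace Ω]
    {Z : Ω → V} (hZ : ∀ v, MeasurableSet {ω | Z ω = v}) (S : Set V) :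
    MeasurableSet {ω | Z ω ∈ S} := by
  have : {ω | Z ω ∈ S} = ⋃ v ∈ S, {ω | Z ω = v} := by ext; simp
  rw [this]
  exact MeasurableSet.biUnion S.to_countable fun v _ => hZ v

theorem measurableSet_forall_le_mem {V Ω : Type*} [Countable V] [MeasurableSpace Ω]
    {Z : ℕ → Ω → V} (hZ : ∀ i v, MeasurableSet {ω | Z i ω = v}) (S : ℕ → Set V) (N : ℕ) :
    MeasurableSet {ω | ∀ i ≤ N, Z i ω ∈ S i} := by
  simp only [Set.ofPred_forall]
  exact MeasurableSet.iInter fun i => MeasurableSet.iInter fun _ =>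
    measurableSet_mem_of_countable (hZ i) _

/-- Disintegration of a cylinder event along the value of one coordinate. -/
theorem measure_forall_le_mem_eq_tsum {V Ω : Type*} [Countable V] [MeasurableSpace Ω]
    (Q : Measure Ω) {Z : ℕ → Ω → V} (hZ : ∀ i v, MeasurableSet {ω | Z i ω = v})
    (S : ℕ → Set V) {N k : ℕ} (hk : k ≤ N) :
    Q {ω | ∀ i ≤ N, Z i ω ∈ S i} =
      ∑' v : S k, Q {ω | ∀ i ≤ N, Z i ω ∈ Function.update S k {v.1} i} := by
  rw [← measure_iUnion]
  · congr 1
    ext ω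
    simp only [Set.mem_ofPred_eq, Set.mem_iUnion]
    constructor
    · intro h
      refine ⟨⟨Z k ω, h k hk⟩, fun i hi => ?_⟩
      rcases eq_or_ne i k with rfl | hik
      · simp
      · simpa [hik] using h i hi
    · rintro ⟨v, hv⟩ i hi
      rcases eq_or_ne i k with rfl | hik
      · have := hv i hi
        simp only [Function.update_self, Set.mem_singleton_iff] at this
        rw [this]; exact v.2
      · simpa [hik] using hv i hi
  · intro v w hvw
    refine Set.disjoint_left.2 fun ω h1 h2 => hvw (Subtype.ext ?_)
    have h1 := h1 k hk
    have h2 := h2 k hk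
    simp only [Function.update_self, Set.mem_singleton_iff] at h1 h2
    rw [← h1, h2]
  · exact fun v => measurableSet_forall_le_mem hZ _ _

section Chains

variable {T V Ω : Type*} [MeasurableSpace Ω] [AddCommMonoid T]
  {P : V → Measure Ω} {J : T → Ω → V}

theorem IsMarkovChain.measure_zero_eq_self (h : IsMarkovChain P J) (x : V) :
    P x {ω | J 0 ω = x} = 1 := by
  have := h.markov 0 (fun _ => 0) (fun _ => x)
  simpa using this

theorem IsMarkovChain.ae_zero_eq (h : IsMarkovChain P J) (x : V) : ∀ᵐ ω ∂(P x), J 0 ω = x := by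
  have := h.isProbabilityMeasure x
  exact (prob_compl_eq_zero_iff (h.measurableSet_eq 0 x)).2 (h.measure_zero_eq_self x)

theorem IsMarkovChain.measure_zero_eq_of_ne (h : IsMarkovChain P J) {x y : V} (hxy : y ≠ x) :
    P x {ω | J 0 ω = y} = 0 := by
  refine measure_mono_null ?_ (h.ae_zero_eq x)
  intro ω hω
  simp only [Set.mem_ofPred_eq] at hω
  simp [hω, hxy]

variable [Countable V]

/-- The Markov property for product events, at a time at which the state is prescribed. -/
theorem IsMarkovChain.measure_forall_le_mem (h : IsMarkovChain P J) (y x : V) (n m : ℕ)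
    (s : ℕ → T) (S : ℕ → Set V) (hS : S n = {x}) :
    P y {ω | ∀ i ≤ n + m, J (∑ j ∈ Finset.range i, s j) ω ∈ S i} =
      P y {ω | ∀ i ≤ n, J (∑ j ∈ Finset.range i, s j) ω ∈ S i} *
        P x {ω | ∀ i ≤ m, J (∑ j ∈ Finset.range i, s (n + j)) ω ∈ S (n + i)} := by
  -- Induction on `k`, where all coordinates from `k` on are prescribed: `k = 0` is the defining
  -- product formula, and `k = n + m + 1` prescribes nothing more.
  suffices H : ∀ (k : ℕ) (S : ℕ → Set V), S n = {x} →
      (∀ i, k ≤ i → i ≤ n + m → ∃ v, S i = {v}) →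
      P y {ω | ∀ i ≤ n + m, J (∑ j ∈ Finset.range i, s j) ω ∈ S i} =
      P y {ω | ∀ i ≤ n, J (∑ j ∈ Finset.range i, s j) ω ∈ S i} *
        P x {ω | ∀ i ≤ m, J (∑ j ∈ Finset.range i, s (n + j)) ω ∈ S (n + i)} from
    H (n + m + 1) S hS fun i h1 h2 => by omega
  intro k
  induction k with
  | zero =>
    intro S hS hv
    have hv' : ∀ i, ∃ v, i ≤ n + m → S i = {v} := fun i => by
      by_cases hi : i ≤ n + m
      · obtain ⟨v, hv⟩ := hv i (Nat.zero_le _) hi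
        exact ⟨v, fun _ => hv⟩
      · exact ⟨x, fun h => absurd h hi⟩
    choose v hv using hv'
    have e1 : {ω | ∀ i ≤ n + m, J (∑ j ∈ Finset.range i, s j) ω ∈ S i} =
        {ω | ∀ i ≤ n + m, J (∑ j ∈ Finset.range i, s j) ω = v i} := by
      ext ω
      exact forall_congr' fun i => forall_congr' fun hi => by rw [hv i hi]; rfl
    have e2 : {ω | ∀ i ≤ n, J (∑ j ∈ Finset.range i, s j) ω ∈ S i} =
        {ω | ∀ i ≤ n, J (∑ j ∈ Finset.range i, s j) ω = v i} := by
      ext ω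
      exact forall_congr' fun i => forall_congr' fun hi => by rw [hv i (by omega)]; rfl
    have e3 : {ω | ∀ i ≤ m, J (∑ j ∈ Finset.range i, s (n + j)) ω ∈ S (n + i)} =
        {ω | ∀ i ≤ m, J (∑ j ∈ Finset.range i, s (n + j)) ω = v (n + i)} := by
      ext ω
      exact forall_congr' fun i => forall_congr' fun hi => by rw [hv (n + i) (by omega)]; rfl
    have hx : v n = x := by
      have := hv n (by omega)
      rw [hS] at this
      exact (Set.singleton_injective this).symm
    rw [e1, e2, e3]
    by_cases hy : v 0 = y
    · subst hy
      have h3 := h.markov m (fun j => s (n + j)) (fun i => v (n + i))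
      simp only [add_zero, hx] at h3
      rw [h.markov, h.markov, h3, Finset.prod_range_add]
      rfl
    · have h0 : ∀ N, P y {ω | ∀ i ≤ N, J (∑ j ∈ Finset.range i, s j) ω = v i} = 0 := fun N => by
        refine measure_mono_null (fun ω hω => ?_) (h.measure_zero_eq_of_ne hy)
        simpa using hω 0 (Nat.zero_le _)
      rw [h0, h0, zero_mul]
  | succ k ih =>
    intro S hS hv
    by_cases hk : k = n ∨ n + m < k
    · refine ih S hS fun i h1 h2 => ?_
      rcases h1.eq_or_lt with rfl | h1
      · rcases hk with rfl | hk
        · exact ⟨x, hS⟩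
        · omega
      · exact hv i h1 h2
    · push Not at hk
      obtain ⟨hkn, hkm⟩ := hk
      have hZ : ∀ (i : ℕ) (v : V), MeasurableSet {ω | J (∑ j ∈ Finset.range i, s j) ω = v} :=
        fun i v => h.measurableSet_eq _ v
      have hZ' : ∀ (i : ℕ) (v : V),
          MeasurableSet {ω | J (∑ j ∈ Finset.range i, s (n + j)) ω = v} :=
        fun i v => h.measurableSet_eq _ v
      have step : ∀ w : S k, _ := fun w => ih (Function.update S k {w.1})
        (by rw [Function.update_of_ne (Ne.symm hkn), hS]) (fun i h1 h2 => by
          rcases h1.eq_or_lt with rfl | h1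
          · exact ⟨w.1, by simp⟩
          · rw [Function.update_of_ne (by omega)]
            exact hv i h1 h2)
      rw [measure_forall_le_mem_eq_tsum (P y) hZ S hkm]
      simp_rw [step]
      -- The disintegrated coordinate belongs to the past factor if `k < n` and to the future factor
      -- if `k > n`.
      rcases lt_or_gt_of_ne hkn with hlt | hgt
      · rw [measure_forall_le_mem_eq_tsum (P y) hZ S hlt.le, ← ENNReal.tsum_mul_right]
        refine tsum_congr fun w => ?_
        congr 2
        ext ω
        refine forall_congr' fun i => forall_congr' fun hi => ?_
        rw [Function.update_of_ne (by omega)]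
      · obtain ⟨r, rfl⟩ := Nat.exists_eq_add_of_lt hgt
        have hr : r + 1 ≤ m := by omega
        rw [measure_forall_le_mem_eq_tsum (P x) hZ' (fun i => S (n + i)) hr,
          ← ENNReal.tsum_mul_left]
        refine tsum_congr fun w => ?_
        congr 2
        · ext ω
          refine forall_congr' fun i => forall_congr' fun hi => ?_
          rw [Function.update_of_ne (by omega)]
        · ext ω
          refine forall_congr' fun i => forall_congr' fun hi => ?_
          rcases eq_or_ne i (r + 1) with rfl | hi'
          · simp [add_assoc]
          · rw [Function.update_of_ne hi', Function.update_of_ne (by omega)]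

/-- The Markov property at a time at which the state is prescribed. -/
theorem IsMarkovChain.measure_past_future (h : IsMarkovChain P J) (y x : V) (n m : ℕ)
    (s : ℕ → T) (A B : ℕ → Set V) :
    P y {ω | (∀ i < n, J (∑ j ∈ Finset.range i, s j) ω ∈ A i) ∧
        J (∑ j ∈ Finset.range n, s j) ω = x ∧
        ∀ i < m, J (∑ j ∈ Finset.range (n + (i + 1)), s j) ω ∈ B i} =
      P y {ω | (∀ i < n, J (∑ j ∈ Finset.range i, s j) ω ∈ A i) ∧
        J (∑ j ∈ Finset.range n, s j) ω = x} *
      P x {ω | ∀ i < m, J (∑ j ∈ Finset.range (i + 1), s (n + j)) ω ∈ B i} := by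
  set S : ℕ → Set V := fun j => if j < n then A j else if j = n then {x} else B (j - n - 1)
    with hSdef
  have hS1 : ∀ j < n, S j = A j := fun j hj => by simp [S, hj]
  have hS2 : S n = {x} := by simp [S]
  have hS3 : ∀ i, S (n + (i + 1)) = B i := fun i => by
    simp [S]
  have key := h.measure_forall_le_mem y x n m s S hS2
  have e2 : {ω | ∀ i ≤ n, J (∑ j ∈ Finset.range i, s j) ω ∈ S i} =
      {ω | (∀ i < n, J (∑ j ∈ Finset.range i, s j) ω ∈ A i) ∧
        J (∑ j ∈ Finset.range n, s j) ω = x} := by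
    ext ω
    constructor
    · intro hω
      refine ⟨fun i hi => hS1 i hi ▸ hω i hi.le, ?_⟩
      have := hω n le_rfl
      rwa [hS2] at this
    · rintro ⟨h1, h2⟩ i hi
      rcases hi.lt_or_eq with hi | rfl
      · rw [hS1 i hi]; exact h1 i hi
      · rw [hS2]; exact h2
  have e1 : {ω | ∀ i ≤ n + m, J (∑ j ∈ Finset.range i, s j) ω ∈ S i} =
      {ω | (∀ i < n, J (∑ j ∈ Finset.range i, s j) ω ∈ A i) ∧
        J (∑ j ∈ Finset.range n, s j) ω = x ∧
        ∀ i < m, J (∑ j ∈ Finset.range (n + (i + 1)), s j) ω ∈ B i} := by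
    ext ω
    constructor
    · intro hω
      refine ⟨fun i hi => hS1 i hi ▸ hω i (by omega), ?_, fun i hi => ?_⟩
      · have := hω n (by omega)
        rwa [hS2] at this
      · rw [← hS3]; exact hω _ (by omega)
    · rintro ⟨h1, h2, h3⟩ i hi
      rcases lt_trichotomy i n with hi' | rfl | hi'
      · rw [hS1 i hi']; exact h1 i hi'
      · rw [hS2]; exact h2
      · obtain ⟨r, rfl⟩ := Nat.exists_eq_add_of_lt hi'
        rw [add_assoc, hS3]; exact h3 r (by omega)
  rw [e1, e2] at key
  rw [key]
  congr 1
  -- The future factor still contains the constraint at increment index 0, which holds almost surely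
  -- under `P x`.
  refine measure_congr ?_
  filter_upwards [h.ae_zero_eq x] with ω hω
  refine propext ⟨fun H i hi => ?_, fun H i hi => ?_⟩
  · have := H (i + 1) hi
    rwa [hS3] at this
  · rcases i with _ | i
    · show J (∑ j ∈ Finset.range 0, s (n + j)) ω ∈ S (n + 0)
      rw [add_zero, hS2]; simpa using hω
    · rw [hS3]; exact H i hi

end Chains
-- Renewal decompositions on a time grid
-- In the coordinates `(i, j - i)` the triangle `i ≤ j < K` lies inside a square.
theorem sum_range_convolution_le (f g : ℕ → ℝ≥0∞) (K : ℕ) :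
    ∑ j ∈ Finset.range K, ∑ i ∈ Finset.range (j + 1), f i * g (j - i) ≤
      (∑ i ∈ Finset.range K, f i) * ∑ r ∈ Finset.range K, g r := by
  calc ∑ j ∈ Finset.range K, ∑ i ∈ Finset.range (j + 1), f i * g (j - i)
      = ∑ i ∈ Finset.range K, ∑ j ∈ Finset.Ico i K, f i * g (j - i) :=
        Finset.sum_comm' fun i j => by simp only [Finset.mem_range, Finset.mem_Ico]; omega
    _ = ∑ i ∈ Finset.range K, f i * ∑ r ∈ Finset.range (K - i), g r := by
        refine Finset.sum_congr rfl fun i _ => ?_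
        rw [Finset.sum_Ico_eq_sum_range, Finset.mul_sum]
        simp
    _ ≤ ∑ i ∈ Finset.range K, f i * ∑ r ∈ Finset.range K, g r := by
        gcongr
        exact Nat.sub_le _ _
    _ = _ := by rw [Finset.sum_mul]

section Grid

variable {T V Ω : Type*} [MeasurableSpace Ω] [AddCommMonoid T]
  {P : V → Measure Ω} {J : T → Ω → V}

/-- On the time grid `ℕ • θ`, no return to `x` after an exit from `x` is seen up to index `j`. -/
def noGridReturn (J : T → Ω → V) (x : V) (θ : T) (j : ℕ) : Set Ω :=
  {ω | ∀ i k, i < k → k ≤ j → J (i • θ) ω ≠ x → J (k • θ) ω ≠ x}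

theorem IsMarkovChain.measurableSet_noGridReturn (h : IsMarkovChain P J) (x : V) (θ : T) (j : ℕ) :
    MeasurableSet (noGridReturn J x θ j) := by
  have : noGridReturn J x θ j = ⋂ (i : ℕ) (k : ℕ) (_ : i < k) (_ : k ≤ j),
      ({ω | J (i • θ) ω = x} ∪ {ω | J (k • θ) ω = x}ᶜ) := by
    ext ω
    simp only [noGridReturn, Set.mem_ofPred_eq, Set.mem_iInter, Set.mem_union, Set.mem_compl_iff]
    refine forall_congr' fun i => forall_congr' fun k => forall_congr' fun _ =>
      forall_congr' fun _ => ?_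
    tauto
  rw [this]
  exact MeasurableSet.iInter fun i => MeasurableSet.iInter fun k => MeasurableSet.iInter fun _ =>
    MeasurableSet.iInter fun _ => (h.measurableSet_eq _ _).union (h.measurableSet_eq _ _).compl

theorem noGridReturn_antitone {T V Ω : Type*} [AddCommMonoid T] (J : T → Ω → V)
    (x : V) (θ : T) : Antitone (noGridReturn J x θ) :=
  fun _ _ hab _ hω i k hik hk => hω i k hik (hk.trans hab)

variable [Countable V]

/-- The Markov property along an arithmetic progression of times. -/
theorem IsMarkovChain.measure_grid (h : IsMarkovChain P J) (y x : V) (s θ : T) (n m : ℕ)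
    (A B : ℕ → Set V) :
    P y {ω | (∀ i < n, J (s + i • θ) ω ∈ A i) ∧ J (s + n • θ) ω = x ∧
        ∀ i < m, J (s + (n + (i + 1)) • θ) ω ∈ B i} =
      P y {ω | (∀ i < n, J (s + i • θ) ω ∈ A i) ∧ J (s + n • θ) ω = x} *
      P x {ω | ∀ i < m, J ((i + 1) • θ) ω ∈ B i} := by
  -- The first increment leads to the offset `s`, so grid index `i` is increment index `i + 1`, and
  -- index 0 is left unconstrained.
  set u : ℕ → T := fun j => if j = 0 then s else θ
  have hu : ∀ i, ∑ j ∈ Finset.range (i + 1), u j = s + i • θ := fun i => by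
    rw [Finset.sum_range_succ']
    simp [u, add_comm]
  have hu' : ∀ i, ∑ j ∈ Finset.range i, u (n + 1 + j) = i • θ := fun i => by
    simp [u]
  have e : ∀ (i : ℕ), n + 1 + (i + 1) = n + (i + 1) + 1 := fun i => by omega
  have key := h.measure_past_future y x (n + 1) m u
    (fun i => if i = 0 then Set.univ else A (i - 1)) B
  have past : ∀ ω, (∀ i < n + 1, J (∑ j ∈ Finset.range i, u j) ω ∈
      (if i = 0 then Set.univ else A (i - 1))) ↔ ∀ i < n, J (s + i • θ) ω ∈ A i := by
    intro ω
    constructor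
    · intro H i hi
      have := H (i + 1) (by omega)
      rwa [hu, if_neg (by omega), Nat.add_sub_cancel] at this
    · rintro H (_ | i) hi
      · simp
      · rw [hu, if_neg (by omega), Nat.add_sub_cancel]
        exact H i (by omega)
  simp only [past, hu', e, hu] at key
  exact key

theorem IsMarkovChain.measure_grid_two (h : IsMarkovChain P J) (y x : V) (s θ : T) (n r : ℕ)
    (A : ℕ → Set V) :
    P y {ω | ((∀ i < n, J (s + i • θ) ω ∈ A i) ∧ J (s + n • θ) ω = x) ∧
        J (s + (n + r) • θ) ω = x} =
      P y {ω | (∀ i < n, J (s + i • θ) ω ∈ A i) ∧ J (s + n • θ) ω = x} *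
      P x {ω | J (r • θ) ω = x} := by
  rcases r with _ | r
  · simp only [add_zero, zero_smul, h.measure_zero_eq_self, mul_one]
    congr 1
    ext ω
    exact ⟨fun H => H.1, fun H => ⟨H, H.2⟩⟩
  · have key := h.measure_grid y x s θ n (r + 1) A (fun i => if i = r then {x} else Set.univ)
    have e : ∀ (Z : ℕ → V), (∀ i < r + 1, Z i ∈ (if i = r then ({x} : Set V) else Set.univ)) ↔
        Z r = x := by
      intro Z
      constructor
      · intro H
        simpa using H r (by omega)
      · intro H i _
        split_ifs with hi
        · rw [hi]; exact H
        · trivial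
    simp only [e (fun i => J (s + (n + (i + 1)) • θ) _), e (fun i => J ((i + 1) • θ) _)] at key
    simpa only [and_assoc] using key

/-- Supermultiplicativity of the transition probabilities. -/
theorem IsMarkovChain.measure_mul_le (h : IsMarkovChain P J) (y x : V) (s u : T) :
    P y {ω | J s ω = x} * P x {ω | J u ω = x} ≤ P y {ω | J (s + u) ω = x} := by
  have := h.measure_grid_two y x s u 0 1 (fun _ => Set.univ)
  simp only [Nat.not_lt_zero, false_imp_iff, implies_true, zero_smul, add_zero, true_and, zero_add,
    one_smul] at this
  rw [← this]
  exact measure_mono fun ω hω => hω.2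

/-- The expected number of visits to `x` along an arithmetic progression is maximal for the chain
that starts in `x`. -/
theorem IsMarkovChain.sum_measure_le (h : IsMarkovChain P J) (y x : V) (s θ : T) (K : ℕ) :
    ∑ j ∈ Finset.range K, P y {ω | J (s + j • θ) ω = x} ≤
      ∑ j ∈ Finset.range K, P x {ω | J (j • θ) ω = x} := by
  classical
  have := h.isProbabilityMeasure y
  -- First entrance into `x` at step `n`; these events are disjoint, so their total mass is at most
  -- 1.
  set F : ℕ → Set Ω := fun n =>
    {ω | (∀ i < n, J (s + i • θ) ω ∈ ({x}ᶜ : Set V)) ∧ J (s + n • θ) ω = x} with hF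
  have hFm : ∀ n, MeasurableSet (F n) := fun n => by
    simp only [hF, Set.ofPred_and, Set.ofPred_forall]
    exact (MeasurableSet.iInter fun i => MeasurableSet.iInter fun _ =>
      measurableSet_mem_of_countable (h.measurableSet_eq _) _).inter (h.measurableSet_eq _ _)
  have hFd : Pairwise (Function.onFun Disjoint F) := by
    have key : ∀ i j, i < j → Disjoint (F i) (F j) := fun i j hij =>
      Set.disjoint_left.2 fun ω h1 h2 => h2.1 i hij h1.2
    intro i j hij
    rcases lt_or_gt_of_ne hij with hij | hij
    · exact key i j hij
    · exact (key j i hij).symm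
  have hF1 : ∑ i ∈ Finset.range K, P y (F i) ≤ 1 := by
    rw [← measure_biUnion_finset (fun i _ j _ hij => hFd hij) (fun i _ => hFm i)]
    exact prob_le_one
  have hle : ∀ j, P y {ω | J (s + j • θ) ω = x} ≤
      ∑ i ∈ Finset.range (j + 1), P y (F i) * P x {ω | J ((j - i) • θ) ω = x} := by
    intro j
    have hcov : {ω | J (s + j • θ) ω = x} ⊆ ⋃ i ∈ Finset.range (j + 1),
        {ω | ((∀ i' < i, J (s + i' • θ) ω ∈ ({x}ᶜ : Set V)) ∧ J (s + i • θ) ω = x) ∧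
        J (s + (i + (j - i)) • θ) ω = x} := by
      intro ω hω
      have hex : ∃ i, J (s + i • θ) ω = x := ⟨j, hω⟩
      have hmin : Nat.find hex ≤ j := Nat.find_min' hex hω
      simp only [Set.mem_iUnion, Finset.mem_range]
      refine ⟨Nat.find hex, by omega, ⟨fun i' hi' => Nat.find_min hex hi', Nat.find_spec hex⟩, ?_⟩
      rw [Nat.add_sub_cancel' hmin]
      exact hω
    refine (measure_mono hcov).trans ((measure_biUnion_finset_le _ _).trans ?_)
    refine Finset.sum_le_sum fun i _ => ?_
    rw [h.measure_grid_two]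
  calc ∑ j ∈ Finset.range K, P y {ω | J (s + j • θ) ω = x}
      ≤ ∑ j ∈ Finset.range K, ∑ i ∈ Finset.range (j + 1),
          P y (F i) * P x {ω | J ((j - i) • θ) ω = x} := Finset.sum_le_sum fun j _ => hle j
    _ ≤ (∑ i ∈ Finset.range K, P y (F i)) * ∑ r ∈ Finset.range K, P x {ω | J (r • θ) ω = x} :=
        sum_range_convolution_le (fun i => P y (F i)) (fun r => P x {ω | J (r • θ) ω = x}) K
    _ ≤ 1 * ∑ r ∈ Finset.range K, P x {ω | J (r • θ) ω = x} := by
        gcongr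
    _ = _ := one_mul _

/-- Decomposition along the last visit to `x`. -/
theorem IsMarkovChain.sum_last_visit (h : IsMarkovChain P J) (x : V) (θ : T) (L : ℕ) :
    ∑ l ∈ Finset.range (L + 1), P x {ω | J (l • θ) ω = x} *
      P x {ω | ∀ i < L - l, J ((i + 1) • θ) ω ≠ x} = 1 := by
  classical
  have := h.isProbabilityMeasure x
  set E : ℕ → Set Ω := fun l =>
    {ω | J (l • θ) ω = x ∧ ∀ i < L - l, J ((l + (i + 1)) • θ) ω ≠ x} with hE
  have hval : ∀ l, P x (E l) = P x {ω | J (l • θ) ω = x} *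
      P x {ω | ∀ i < L - l, J ((i + 1) • θ) ω ≠ x} := fun l => by
    simpa using h.measure_grid x x 0 θ l (L - l) (fun _ => Set.univ) (fun _ => {x}ᶜ)
  have hEm : ∀ l, MeasurableSet (E l) := fun n => by
    simp only [hE, Set.ofPred_and, Set.ofPred_forall]
    exact (h.measurableSet_eq _ _).inter (MeasurableSet.iInter fun i => MeasurableSet.iInter fun _ =>
      (h.measurableSet_eq _ _).compl)
  have hEd : Set.PairwiseDisjoint (↑(Finset.range (L + 1))) E := by
    have key : ∀ i j, i < j → j < L + 1 → Disjoint (E i) (E j) := fun i j hij hj =>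
      Set.disjoint_left.2 fun ω h1 h2 => by
        have := h1.2 (j - i - 1) (by omega)
        rw [show i + (j - i - 1 + 1) = j by omega] at this
        exact this h2.1
    intro i hi j hj hij
    simp only [Finset.coe_range, Set.mem_Iio] at hi hj
    rcases lt_or_gt_of_ne hij with hij | hij
    · exact key i j hij hj
    · exact (key j i hij hi).symm
  simp_rw [← hval]
  rw [← measure_biUnion_finset hEd (fun i _ => hEm i)]
  refine le_antisymm prob_le_one ?_
  rw [← h.measure_zero_eq_self x]
  refine measure_mono fun ω hω => ?_
  have hω : J 0 ω = x := hω
  have h0 : J ((0 : ℕ) • θ) ω = x := by simpa using hω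
  simp only [Set.mem_iUnion, Finset.mem_range]
  refine ⟨Nat.findGreatest (fun l => J (l • θ) ω = x) L,
    Nat.lt_succ_of_le (Nat.findGreatest_le _), ?_, fun i hi => ?_⟩
  · exact Nat.findGreatest_spec (P := fun l => J (l • θ) ω = x) (Nat.zero_le L) h0
  · exact Nat.findGreatest_is_greatest (P := fun l => J (l • θ) ω = x) (n := L) (by omega) (by omega)

/-- Sum the last-visit identity over `L < M`. Any bound on the avoidance sum thus becomes a linear
lower bound on the visits. -/
theorem IsMarkovChain.le_sum_visits_mul (h : IsMarkovChain P J) (x : V) (θ : T) (M : ℕ) :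
    (M : ℝ≥0∞) ≤ (∑ l ∈ Finset.range M, P x {ω | J (l • θ) ω = x}) *
      ∑ j ∈ Finset.range M, P x {ω | ∀ i < j, J ((i + 1) • θ) ω ≠ x} := by
  refine le_trans (le_of_eq ?_) (sum_range_convolution_le _ _ M)
  simp [h.sum_last_visit x θ]

/-- A long excursion from `x` that starts with the first step has small probability compared with
a long excursion that starts later. -/
theorem IsMarkovChain.mul_measure_excursion_le (h : IsMarkovChain P J) (x : V) (θ : T) (n j : ℕ)
    (hj : 0 < j) :
    n * (P x {ω | ∀ i < n, J (i • θ) ω = x} * P x {ω | ∀ i < j, J ((i + 1) • θ) ω ≠ x}) ≤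
      P x (noGridReturn J x θ j) := by
  -- The chain sits in `x` through step `k` and then avoids it for `j` steps. These events are
  -- disjoint because `j > 0`, and for `k < n` each has at least the probability of staying `n`
  -- steps times that of avoiding `j` steps.
  set D : ℕ → Set Ω := fun k => {ω | (∀ i < k, J (i • θ) ω = x) ∧ J (k • θ) ω = x ∧
      ∀ i < j, J ((k + (i + 1)) • θ) ω ≠ x} with hD
  have hDm : ∀ k, MeasurableSet (D k) := fun k => by
    simp only [hD, Set.ofPred_and, Set.ofPred_forall]
    exact (MeasurableSet.iInter fun i => MeasurableSet.iInter fun _ =>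
      (h.measurableSet_eq _ _)).inter ((h.measurableSet_eq _ _).inter
      (MeasurableSet.iInter fun i => MeasurableSet.iInter fun _ =>
      (h.measurableSet_eq _ _).compl))
  have hval : ∀ k, P x (D k) = P x {ω | (∀ i < k, J (i • θ) ω = x) ∧ J (k • θ) ω = x} *
      P x {ω | ∀ i < j, J ((i + 1) • θ) ω ≠ x} := fun k => by
    simpa using h.measure_grid x x 0 θ k j (fun _ => {x}) (fun _ => {x}ᶜ)
  have hDd : Set.PairwiseDisjoint (↑(Finset.range n)) D := by
    have key : ∀ i k, i < k → Disjoint (D i) (D k) := fun i k hik =>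
      Set.disjoint_left.2 fun ω h1 h2 => by
        have h3 := h1.2.2 0 hj
        rcases (Nat.succ_le_of_lt hik).lt_or_eq with hik | hik
        · exact h3 (h2.1 _ hik)
        · subst hik
          exact h3 (by simpa using h2.2.1)
    intro i _ k _ hik
    rcases lt_or_gt_of_ne hik with hik | hik
    · exact key i k hik
    · exact (key k i hik).symm
  have hsub : ∀ k, D k ⊆ noGridReturn J x θ j := by
    intro k ω hω a b hab hb ha
    have hka : k < a := by
      by_contra hcon
      rcases (not_lt.1 hcon).lt_or_eq with hlt | rfl
      · exact ha (hω.1 a hlt)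
      · exact ha hω.2.1
    have := hω.2.2 (b - k - 1) (by omega)
    rwa [show k + (b - k - 1 + 1) = b by omega] at this
  calc n * (P x {ω | ∀ i < n, J (i • θ) ω = x} * P x {ω | ∀ i < j, J ((i + 1) • θ) ω ≠ x})
      = ∑ k ∈ Finset.range n, P x {ω | ∀ i < n, J (i • θ) ω = x} *
          P x {ω | ∀ i < j, J ((i + 1) • θ) ω ≠ x} := by simp
    _ ≤ ∑ k ∈ Finset.range n, P x (D k) := by
        refine Finset.sum_le_sum fun k hk => ?_
        rw [hval]
        refine mul_le_mul' (measure_mono fun ω hω => ?_) le_rfl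
        have hk := Finset.mem_range.1 hk
        exact ⟨fun i hi => hω i (hi.trans hk), hω k hk⟩
    _ = P x (⋃ k ∈ Finset.range n, D k) := (measure_biUnion_finset hDd (fun i _ => hDm i)).symm
    _ ≤ _ := measure_mono (Set.iUnion₂_subset fun k _ => hsub k)

end Grid

/-! ### Auxiliary bounds and initial laws -/

theorem exists_half_le_measure_of_monotone {Ω : Type*} [MeasurableSpace Ω] (Q : Measure Ω)
    [IsProbabilityMeasure Q] {C : ℕ → Set Ω} (hC : Monotone C) (h : ∀ᵐ ω ∂Q, ∃ n, ω ∈ C n) :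
    ∃ n, 1 ≤ n ∧ 2⁻¹ ≤ Q (C n) := by
  have h1 : Q (⋃ n, C n) = 1 := by
    rw [← measure_univ (μ := Q)]
    refine measure_congr ?_
    filter_upwards [h] with ω hω
    exact propext ⟨fun _ => trivial, fun _ => Set.mem_iUnion.2 hω⟩
  have h2 := tendsto_measure_iUnion_atTop (μ := Q) hC
  rw [h1] at h2
  obtain ⟨n, hn1, hn2⟩ := ((h2.eventually (lt_mem_nhds (b := 1) (a := 2⁻¹) (by
    rw [ENNReal.inv_lt_one]; norm_num))).and (eventually_ge_atTop 1)).exists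
  exact ⟨n, hn2, hn1.le⟩

theorem le_two_mul_of_half_le {a b c : ℝ≥0∞} (hc : 2⁻¹ ≤ c) (h : a * c ≤ b) : a ≤ 2 * b := by
  calc a = 2 * (a * 2⁻¹) := by
        rw [mul_left_comm, ENNReal.mul_inv_cancel (by norm_num) (by norm_num), mul_one]
    _ ≤ 2 * (a * c) := by gcongr
    _ ≤ 2 * b := by gcongr

/-- Sums of a summable sequence along injective index maps that leave every bounded set tend to
zero. -/
theorem tendsto_sum_Ico_of_le_summable {q : ℕ → ℝ} (hq : Summable q) (hq0 : ∀ i, 0 ≤ q i)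
    {f : ℕ → ℕ → ℝ} (hf0 : ∀ n k, 0 ≤ f n k) (φ : ℕ → ℕ → ℕ) (b K : ℕ → ℕ) {C : ℝ} (hC : 0 ≤ C)
    (hb : Tendsto b atTop atTop)
    (h : ∀ᶠ n in atTop, Function.Injective (φ n) ∧
      ∀ k, 1 ≤ k → b n ≤ φ n k ∧ f n k ≤ C * q (φ n k)) :
    Tendsto (fun n => ∑ k ∈ Finset.Ico 1 (K n), f n k) atTop (𝓝 0) := by
  have lim : Tendsto (fun n => C * ∑' k, q (k + b n)) atTop (𝓝 0) := by
    have := ((tendsto_sum_nat_add q).comp hb).const_mul C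
    simpa using this
  refine tendsto_of_tendsto_of_tendsto_of_le_of_le' tendsto_const_nhds lim
    (Eventually.of_forall fun n => Finset.sum_nonneg fun k _ => hf0 n k) ?_
  filter_upwards [h] with n ⟨hinj, hn⟩
  -- The subtraction is not truncated, since `b n ≤ φ n k` for `k ≥ 1`.
  have hinj' : Set.InjOn (fun k => φ n k - b n) (Finset.Ico 1 (K n)) := by
    intro k hk l hl hkl
    have h1 := (hn k (Finset.mem_Ico.1 hk).1).1
    have h2 := (hn l (Finset.mem_Ico.1 hl).1).1
    refine hinj ?_
    simp only at hkl
    omega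
  calc ∑ k ∈ Finset.Ico 1 (K n), f n k
      ≤ ∑ k ∈ Finset.Ico 1 (K n), C * q (φ n k - b n + b n) := by
        refine Finset.sum_le_sum fun k hk => ?_
        have := hn k (Finset.mem_Ico.1 hk).1
        rw [Nat.sub_add_cancel this.1]
        exact this.2
    _ = C * ∑ i ∈ (Finset.Ico 1 (K n)).image (fun k => φ n k - b n), q (i + b n) := by
        rw [Finset.sum_image hinj', Finset.mul_sum]
    _ ≤ _ := by
        gcongr
        exact ((summable_nat_add_iff (b n)).2 hq).sum_le_tsum _ fun i _ => hq0 _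

section InitLaw

variable {T V Ω : Type*} [MeasurableSpace Ω] {P : V → Measure Ω} {J : T → Ω → V}

theorem initLaw_apply (P : V → Measure Ω) (μ : PMF V) {A : Set Ω} (hA : MeasurableSet A) :
    initLaw P μ A = ∑' y, μ y * P y A := by
  simp [initLaw, Measure.sum_apply _ hA]

theorem isProbabilityMeasure_initLaw (hP : ∀ x, IsProbabilityMeasure (P x)) (μ : PMF V) :
    IsProbabilityMeasure (initLaw P μ) :=
  ⟨by rw [initLaw_apply P μ MeasurableSet.univ]; simp [μ.tsum_coe]⟩

theorem IsMarkovChain.initLaw_mul_le [Countable V] [AddCommMonoid T] (h : IsMarkovChain P J)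
    (μ : PMF V) (x : V) (s u : T) :
    initLaw P μ {ω | J s ω = x} * P x {ω | J u ω = x} ≤ initLaw P μ {ω | J (s + u) ω = x} := by
  rw [initLaw_apply P μ (h.measurableSet_eq _ _), initLaw_apply P μ (h.measurableSet_eq _ _),
    ← ENNReal.tsum_mul_right]
  refine ENNReal.tsum_le_tsum fun y => ?_
  rw [mul_assoc]
  gcongr
  exact h.measure_mul_le y x s u

theorem IsMarkovChain.skeleton [AddCommMonoid T] (h : IsMarkovChain P J) (θ : T) :
    IsMarkovChain P (fun k : ℕ => J (k • θ)) where
  isProbabilityMeasure := h.isProbabilityMeasure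
  measurableSet_eq _ _ := h.measurableSet_eq _ _
  markov n s y := by
    have := h.markov n (fun j => s j • θ) y
    simpa only [Finset.sum_smul] using this

end InitLaw

/-! ### Transient states -/

section Transient

variable {V Ω : Type*} [MeasurableSpace Ω] {P : V → Measure Ω}

/-- Discrete time: the expected number of visits to a transient state is bounded, uniformly in the
starting point. -/
theorem IsMarkovChain.exists_tsum_le_of_isTransient [Countable V] {J : ℕ → Ω → V}
    (h : IsMarkovChain P J) {x : V} (hx : IsTransient P J x) :
    ∃ B : ℝ≥0∞, B ≠ ∞ ∧ ∀ y, ∑' m, P y {ω | J m ω = x} ≤ B := by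
  have := h.isProbabilityMeasure x
  -- With probability at least 1/2 there is no visit from time `N` on. On the grid of step `N` every
  -- avoidance factor in the last-visit identity is then at least 1/2, which bounds the visits by 2.
  obtain ⟨N, hN1, hN⟩ := exists_half_le_measure_of_monotone (P x)
    (C := fun N => {ω | ∀ m, N ≤ m → J m ω ≠ x})
    (fun a b hab ω hω m hm => hω m (hab.trans hm)) (by
      filter_upwards [hx] with ω ⟨b, hb⟩
      exact ⟨b + 1, fun m hm hmx => by have := hb hmx; omega⟩)
  have hgrid : ∀ K, ∑ l ∈ Finset.range K, P x {ω | J (l • N) ω = x} ≤ 2 := by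
    intro K
    rcases K with _ | L
    · simp
    rw [← mul_one 2, ← h.sum_last_visit x N L]
    refine le_two_mul_of_half_le (c := 2⁻¹) le_rfl ?_
    rw [Finset.sum_mul]
    refine Finset.sum_le_sum fun l _ => ?_
    gcongr
    refine hN.trans (measure_mono fun ω hω i _ => hω _ ?_)
    rw [smul_eq_mul]
    exact Nat.le_mul_of_pos_left _ (Nat.succ_pos i)
  have : NeZero N := ⟨by omega⟩
  refine ⟨N * 2, ENNReal.mul_ne_top (by simp) (by simp), fun y => ?_⟩
  -- Split the times by residue modulo `N`; each of the `N` progressions contributes at most 2.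
  rw [← (Nat.divModEquiv N).symm.tsum_eq, ENNReal.tsum_prod', ENNReal.tsum_comm, tsum_fintype]
  calc _ ≤ ∑ _r : Fin N, (2 : ℝ≥0∞) := by
        refine Finset.sum_le_sum fun r _ => ENNReal.tsum_le_of_sum_range_le fun K => ?_
        refine le_trans (le_of_eq ?_) ((h.sum_measure_le y x r.val N K).trans (hgrid K))
        refine Finset.sum_congr rfl fun q _ => ?_
        congr 3
        ext ω
        simp [Nat.divModEquiv, add_comm, mul_comm]
    _ = _ := by simp

theorem IsMarkovChain.tsum_initLaw_ne_top [Countable V] {J : ℕ → Ω → V}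
    (h : IsMarkovChain P J) (μ : PMF V) {x : V} (hx : IsTransient P J x) :
    ∑' m, initLaw P μ {ω | J m ω = x} ≠ ∞ := by
  obtain ⟨B, hB, hBle⟩ := h.exists_tsum_le_of_isTransient hx
  refine ne_top_of_le_ne_top hB ?_
  simp_rw [fun m => initLaw_apply P μ (h.measurableSet_eq m x)]
  rw [ENNReal.tsum_comm]
  calc ∑' y, ∑' m, μ y * P y {ω | J m ω = x} ≤ ∑' y, μ y * B := by
        refine ENNReal.tsum_le_tsum fun y => ?_
        rw [ENNReal.tsum_mul_left]
        gcongr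
        exact hBle y
    _ = B := by rw [ENNReal.tsum_mul_right, μ.tsum_coe, one_mul]

/-- Makes the return sum the special case `μ = δ_x` of the occupation sum. -/
theorem visitSum_initLaw_pure {T : Type*} [AddCommMonoid T] {J : T → Ω → V}
    (h : IsMarkovChain P J) (x : V) (θ : T) (k : ℕ) :
    visitSum (P x) J θ k x = visitSum (initLaw P (PMF.pure x)) J θ k x := by
  classical
  refine Finset.sum_congr rfl fun j _ => ?_
  rw [measureReal_def, measureReal_def, initLaw_apply P _ (h.measurableSet_eq _ _),
    tsum_eq_single x (fun y hy => by simp [hy])]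
  simp

theorem IsMarkovChain.tendsto_visitSum_of_isTransient [Countable V] {J : ℕ → Ω → V}
    (h : IsMarkovChain P J) (μ : PMF V) {x : V} (hx : IsTransient P J x) {θ : ℕ → ℕ}
    (hθ : Tendsto θ atTop atTop)
    (K : ℕ → ℕ) :
    Tendsto (fun n => visitSum (initLaw P μ) J (θ n) (K n) x) atTop (𝓝 0) := by
  have := isProbabilityMeasure_initLaw h.isProbabilityMeasure μ
  refine tendsto_sum_Ico_of_le_summable (ENNReal.summable_toReal (h.tsum_initLaw_ne_top μ hx))
    (fun _ => ENNReal.toReal_nonneg) (fun _ _ => measureReal_nonneg) (fun n k => k • θ n) θ K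
    zero_le_one hθ ?_
  filter_upwards [hθ.eventually_ge_atTop 1] with n hn
  refine ⟨fun a b hab => ?_, fun k hk => ⟨?_, ?_⟩⟩
  · exact Nat.eq_of_mul_eq_mul_right hn hab
  · exact Nat.le_mul_of_pos_left _ hk
  · rw [one_mul]; rfl

/-- With probability at least `1/2` the chain stays in its initial state for some fixed time. -/
theorem IsNonexplosiveChain.exists_holding {J : ℝ≥0 → Ω → V} (h : IsNonexplosiveChain P J)
    (x : V) : ∃ η : ℝ≥0, 0 < η ∧ 2⁻¹ ≤ P x {ω | ∀ u ≤ η, J u ω = x} := by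
  have := h.isProbabilityMeasure x
  obtain ⟨n, -, hn⟩ := exists_half_le_measure_of_monotone (P x)
    (C := fun n => {ω | ∀ u ≤ ((n : ℝ≥0) + 1)⁻¹, J u ω = x})
    (fun a b hab ω hω u hu => hω u (hu.trans (by gcongr))) (by
      filter_upwards [h.step x, h.ae_zero_eq x] with ω hω h0
      have hr : ∀ᶠ s in 𝓝[>] (0 : ℝ≥0), J s ω = J 0 ω := hω.1 0
      rw [h0] at hr
      obtain ⟨ε, hε, hs⟩ := mem_nhdsGT_iff_exists_Ioo_subset.1 hr
      have hε : (0 : ℝ≥0) < ε := hε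
      obtain ⟨n, hn⟩ := exists_nat_one_div_lt hε
      refine ⟨n, fun u hu => ?_⟩
      rcases eq_or_lt_of_le (zero_le : 0 ≤ u) with rfl | hu0
      · exact h0
      · refine hs ⟨hu0, hu.trans_lt ?_⟩
        simpa using hn)
  exact ⟨_, by positivity, hn⟩

theorem IsTransient.skeleton {J : ℝ≥0 → Ω → V} {x : V} (hx : IsTransient P J x) {η : ℝ≥0}
    (hη : 0 < η) : IsTransient P (fun k : ℕ => J (k • η)) x := by
  filter_upwards [hx] with ω ⟨b, hb⟩
  refine ⟨⌈b / η⌉₊, fun k hk => ?_⟩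
  have h1 : k • η ≤ b := hb hk
  rw [nsmul_eq_mul, ← le_div_iff₀ hη] at h1
  exact_mod_cast h1.trans (Nat.le_ceil _)

/-- Rounding `k • θ n` up to a multiple of `η` costs a factor 2, by holding. Once `θ n ≥ η`,
distinct `k` round to distinct multiples, so the summable `η`-skeleton dominates. -/
theorem IsNonexplosiveChain.tendsto_visitSum_of_isTransient [Countable V] {J : ℝ≥0 → Ω → V}
    (h : IsNonexplosiveChain P J) (μ : PMF V) {x : V} (hx : IsTransient P J x) {θ : ℕ → ℝ≥0}
    (hθ : Tendsto θ atTop atTop) (K : ℕ → ℕ) :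
    Tendsto (fun n => visitSum (initLaw P μ) J (θ n) (K n) x) atTop (𝓝 0) := by
  have := isProbabilityMeasure_initLaw h.isProbabilityMeasure μ
  obtain ⟨η, hη, hhold⟩ := h.exists_holding x
  have hsum := (h.toIsMarkovChain.skeleton η).tsum_initLaw_ne_top μ (hx.skeleton hη)
  refine tendsto_sum_Ico_of_le_summable (ENNReal.summable_toReal hsum)
    (fun _ => ENNReal.toReal_nonneg) (fun _ _ => measureReal_nonneg)
    (fun n k => ⌈(k • θ n) / η⌉₊) (fun n => ⌈θ n / η⌉₊) K (C := 2) zero_le_two ?_ ?_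
  · exact tendsto_nat_ceil_atTop.comp (hθ.atTop_div_const hη)
  filter_upwards [hθ.eventually_ge_atTop η] with n hn
  refine ⟨(strictMono_nat_of_lt_succ fun k => ?_).injective, fun k hk => ⟨?_, ?_⟩⟩
  · rw [Nat.lt_ceil]
    have h1 : (1 : ℝ≥0) ≤ θ n / η := by rwa [one_le_div₀ hη]
    have h2 := Nat.ceil_lt_add_one (zero_le : 0 ≤ k • θ n / η)
    rw [succ_nsmul, add_div]
    exact h2.trans_le (by gcongr)
  · refine Nat.ceil_mono ?_
    gcongr
    simpa using nsmul_le_nsmul_left (zero_le : 0 ≤ θ n) hk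
  · set m := ⌈(k • θ n) / η⌉₊ with hm
    have h1 : k • θ n ≤ m • η := by
      rw [nsmul_eq_mul m, ← div_le_iff₀ hη]
      exact Nat.le_ceil _
    have h2 : m • η ≤ k • θ n + η := by
      have := (Nat.ceil_lt_add_one (zero_le : 0 ≤ k • θ n / η)).le
      rw [← hm] at this
      calc m • η = (m : ℝ≥0) * η := nsmul_eq_mul _ _
        _ ≤ (k • θ n / η + 1) * η := by gcongr
        _ = _ := by rw [add_mul, div_mul_cancel₀ _ hη.ne', one_mul]
    have h3 := h.initLaw_mul_le μ x (k • θ n) (m • η - k • θ n)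
    rw [add_tsub_cancel_of_le h1] at h3
    have h4 := le_two_mul_of_half_le (hhold.trans
      (measure_mono fun ω (hω : ∀ u ≤ η, J u ω = x) => hω _ (tsub_le_iff_left.2 h2))) h3
    have h5 := ENNReal.toReal_mono (ENNReal.mul_ne_top (by simp) (measure_ne_top _ _)) h4
    rw [ENNReal.toReal_mul] at h5
    exact h5

end Transient

/-! ### Dyadic grids and the continuous return time -/

theorem sum_range_mul_le {f g : ℕ → ℝ≥0∞} {n : ℕ} (M : ℕ)
    (h : ∀ i < M, ∀ k < n, f (i * n + k) ≤ g i) :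
    ∑ j ∈ Finset.range (M * n), f j ≤ n * ∑ i ∈ Finset.range M, g i := by
  induction M with
  | zero => simp
  | succ M ih =>
    rw [Nat.succ_mul, Finset.sum_range_add, Finset.sum_range_succ, mul_add]
    refine add_le_add (ih fun i hi => h i (by omega)) ?_
    calc ∑ k ∈ Finset.range n, f (M * n + k) ≤ ∑ _k ∈ Finset.range n, g M :=
          Finset.sum_le_sum fun k hk => h M (by omega) k (Finset.mem_range.1 hk)
      _ = _ := by simp

theorem sum_range_le_one_add {f : ℕ → ℝ≥0∞} {z : ℝ≥0∞} (hf : ∀ i, f i ≤ 1)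
    (h : ∀ i, f i ≠ 0 → (i : ℝ≥0∞) ≤ z) (M : ℕ) : ∑ i ∈ Finset.range M, f i ≤ 1 + z := by
  induction M with
  | zero => simp
  | succ M ih =>
    by_cases hM : f M = 0
    · rwa [Finset.sum_range_succ, hM, add_zero]
    · calc ∑ i ∈ Finset.range (M + 1), f i ≤ ∑ _i ∈ Finset.range (M + 1), (1 : ℝ≥0∞) :=
            Finset.sum_le_sum fun i _ => hf i
        _ = 1 + M := by simp [add_comm]
        _ ≤ 1 + z := by gcongr; exact h M hM

theorem exists_nat_mul_pow_mem_Ioo {s s' η : ℝ≥0} (h : s < s') (hη : 0 < η) :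
    ∀ᶠ m : ℕ in atTop, ∃ a : ℕ, s < a • (η / 2 ^ m) ∧ a • (η / 2 ^ m) < s' := by
  have h1 : Tendsto (fun m : ℕ => η / 2 ^ m) atTop (𝓝 0) := by
    have := (NNReal.tendsto_pow_atTop_nhds_zero_of_lt_one (r := 2⁻¹)
      (by rw [← NNReal.coe_lt_coe]; norm_num)).const_mul η
    simpa [div_eq_mul_inv] using this
  filter_upwards [h1.eventually_lt_const (tsub_pos_of_lt h)] with m hm
  have hδ : 0 < η / 2 ^ m := by positivity
  refine ⟨⌊s / (η / 2 ^ m)⌋₊ + 1, ?_, ?_⟩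
  · rw [nsmul_eq_mul, ← div_lt_iff₀ hδ]
    exact_mod_cast Nat.lt_floor_add_one _
  · rw [succ_nsmul, nsmul_eq_mul]
    have h2 : (⌊s / (η / 2 ^ m)⌋₊ : ℝ≥0) * (η / 2 ^ m) ≤ s := by
      rw [← le_div_iff₀ hδ]
      exact Nat.floor_le zero_le
    calc _ ≤ s + η / 2 ^ m := by gcongr
      _ < s' := by rwa [add_comm, ← lt_tsub_iff_right]

section Dyadic

variable {V Ω : Type*}

/-- No return to `x` is seen up to time `i • η` on any of the dyadic refinements of the grid
`ℕ • η`. -/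
def noDyadicReturn (J : ℝ≥0 → Ω → V) (x : V) (η : ℝ≥0) (i : ℕ) : Set Ω :=
  ⋂ m : ℕ, noGridReturn J x (η / 2 ^ m) (i * 2 ^ m)

theorem antitone_noGridReturn_dyadic (J : ℝ≥0 → Ω → V) (x : V) (η : ℝ≥0) (i : ℕ) :
    Antitone fun m : ℕ => noGridReturn J x (η / 2 ^ m) (i * 2 ^ m) := by
  refine antitone_nat_of_succ_le fun m ω hω a b hab hb => ?_
  have e : ∀ a : ℕ, (2 * a) • (η / 2 ^ (m + 1)) = a • (η / 2 ^ m) := fun a => by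
    rw [nsmul_eq_mul, nsmul_eq_mul]
    push_cast
    field_simp
    ring
  have := hω (2 * a) (2 * b) (by omega) (by rw [pow_succ, mul_comm _ 2, mul_left_comm]; omega)
  rwa [e, e] at this

/-- By right-continuity, an absence at `s` and a return at `t < i * η` both persist on short
intervals to the right. A fine enough dyadic grid has points in both intervals and sees the return.
-/
theorem le_returnTimeC_of_mem_noDyadicReturn {J : ℝ≥0 → Ω → V} {x : V} {η : ℝ≥0} (hη : 0 < η)
    {i : ℕ} {ω : Ω} (hstep : IsStepPath fun t => J t ω) (hω : ω ∈ noDyadicReturn J x η i) :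
    (i : ℝ≥0∞) * η ≤ returnTimeC J x ω := by
  refine le_iInf₂ fun t ⟨ht, s, hst, hs⟩ => ?_
  by_contra! hlt
  have hlt : t < i * η := by exact_mod_cast hlt
  have right : ∀ (r r' : ℝ≥0), r < r' → ∃ q > r, q ≤ r' ∧ ∀ u, r < u → u < q → J u ω = J r ω := by
    intro r r' hr
    have h1 : ∀ᶠ u in 𝓝[>] r, J u ω = J r ω := hstep.1 r
    obtain ⟨q, hq, hsub⟩ := (mem_nhdsGT_iff_exists_Ioo_subset' hr).1 h1
    exact ⟨min q r', lt_min hq hr, min_le_right _ _,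
      fun u hu huq => hsub ⟨hu, huq.trans_le (min_le_left _ _)⟩⟩
  obtain ⟨s', hs', hs't, hsJ⟩ := right s t hst
  obtain ⟨t', ht', ht'i, htJ⟩ := right t _ hlt
  obtain ⟨m, ⟨a, ha1, ha2⟩, b, hb1, hb2⟩ :=
    ((exists_nat_mul_pow_mem_Ioo hs' hη).and (exists_nat_mul_pow_mem_Ioo ht' hη)).exists
  have hδ : 0 < η / 2 ^ m := by positivity
  refine Set.mem_iInter.1 hω m a b ?_ ?_ (by rwa [hsJ _ ha1 ha2]) (by rwa [htJ _ hb1 hb2])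
  · have := (ha2.trans_le hs't).trans hb1
    rw [nsmul_eq_mul, nsmul_eq_mul, mul_lt_mul_iff_left₀ hδ] at this
    exact_mod_cast this
  · have e : (i : ℝ≥0) * η = ((i * 2 ^ m : ℕ) : ℝ≥0) * (η / 2 ^ m) := by
      push_cast
      field_simp
    have := hb2.le.trans ht'i
    rw [e, nsmul_eq_mul, mul_le_mul_iff_left₀ hδ] at this
    exact_mod_cast this

end Dyadic

/-! ### Positive frequency of visits -/

section Frequency

variable {T V Ω : Type*} [MeasurableSpace Ω] {P : V → Measure Ω}

/-- If `x` is visited with positive frequency along one arithmetic progression of times, then the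
expected number of visits along any other progression grows linearly, with a uniform rate. -/
theorem IsMarkovChain.mul_le_two_mul_sum_of_frequency [Countable V] [AddCommMonoid T]
    {J : T → Ω → V} (h : IsMarkovChain P J) (x : V) (η : T) {c : ℝ}
    (hfreq : ∀ M : ℕ, c * M ≤ ∑ l ∈ Finset.range M, (P x).real {ω | J (l • η) ω = x})
    (hshift : ∀ t, ∃ l₀ : ℕ, ∀ l : ℕ,
      (P x).real {ω | J ((l₀ + l) • η) ω = x} ≤ 2 * (P x).real {ω | J (l • η + t) ω = x})
    (θ : T) (K : ℕ) :
    c * K ≤ 2 * ∑ j ∈ Finset.range K, (P x).real {ω | J (j • θ) ω = x} := by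
  have := h.isProbabilityMeasure x
  set p : T → ℝ := fun t => (P x).real {ω | J t ω = x} with hp
  change ∀ t, ∃ l₀ : ℕ, ∀ l : ℕ, p ((l₀ + l) • η) ≤ 2 * p (l • η + t) at hshift
  change ∀ M : ℕ, c * M ≤ ∑ l ∈ Finset.range M, p (l • η) at hfreq
  change c * K ≤ 2 * ∑ j ∈ Finset.range K, p (j • θ)
  set G := ∑ j ∈ Finset.range K, p (j • θ)
  have hG : ∀ s, ∑ j ∈ Finset.range K, p (s + j • θ) ≤ G := fun s => by
    have := ENNReal.toReal_mono (by simp) (h.sum_measure_le x x s θ K)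
    rwa [ENNReal.toReal_sum (by simp), ENNReal.toReal_sum (by simp)] at this
  choose b hb using fun j : ℕ => hshift (j • θ)
  -- Evaluate the sum of `p (l • η + j • θ)` over `l < L`, `j < K` in two ways: for fixed `l` it is
  -- at most `G`, for fixed `j` the frequency bound applies up to an error independent of `L`. Large
  -- `L` then forces `c * K ≤ 2 * G`.
  have hL : ∀ L : ℕ, L * (c * K - 2 * G) ≤ ∑ j ∈ Finset.range K, ((b j : ℝ) - c * b j) := by
    intro L
    have h1 : ∑ l ∈ Finset.range L, ∑ j ∈ Finset.range K, p (l • η + j • θ) ≤ L * G := by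
      refine (Finset.sum_le_sum fun l _ => hG (l • η)).trans (le_of_eq ?_)
      simp
    have h2 : ∀ j, c * L - (b j - c * b j) ≤ 2 * ∑ l ∈ Finset.range L, p (l • η + j • θ) := by
      intro j
      have e1 := hfreq (b j + L)
      rw [Finset.sum_range_add] at e1
      have e2 : ∑ l ∈ Finset.range (b j), p (l • η) ≤ b j := by
        refine (Finset.sum_le_sum fun l _ => measureReal_le_one).trans (le_of_eq ?_)
        simp
      have e3 : ∑ l ∈ Finset.range L, p ((b j + l) • η) ≤
          2 * ∑ l ∈ Finset.range L, p (l • η + j • θ) := by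
        rw [Finset.mul_sum]
        exact Finset.sum_le_sum fun l _ => hb j l
      push_cast at e1
      linarith
    have h3 := Finset.sum_le_sum fun j (_ : j ∈ Finset.range K) => h2 j
    rw [Finset.sum_sub_distrib, Finset.sum_const, Finset.card_range, ← Finset.mul_sum,
      Finset.sum_comm, nsmul_eq_mul] at h3
    nlinarith
  by_contra! hcon
  obtain ⟨L, hL'⟩ := exists_nat_gt
    ((∑ j ∈ Finset.range K, ((b j : ℝ) - c * b j)) / (c * K - 2 * G))
  rw [div_lt_iff₀ (by linarith)] at hL'
  exact absurd (hL L) (not_le.2 hL')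

theorem frequency_of_le_mul [AddCommMonoid T] {J : T → Ω → V} (h : IsMarkovChain P J) (x : V)
    (η : T) {C : ℝ≥0∞} (hC : C ≠ ∞)
    (hM : ∀ M : ℕ, (M : ℝ≥0∞) ≤ (∑ l ∈ Finset.range M, P x {ω | J (l • η) ω = x}) * C) :
    ∃ c > 0, ∀ M : ℕ, c * M ≤ ∑ l ∈ Finset.range M, (P x).real {ω | J (l • η) ω = x} := by
  have := h.isProbabilityMeasure x
  have hC0 : (0 : ℝ) ≤ C.toReal := ENNReal.toReal_nonneg
  refine ⟨(C.toReal + 1)⁻¹, by positivity, fun M => ?_⟩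
  have h1 := ENNReal.toReal_mono (ENNReal.mul_ne_top (by simp) hC) (hM M)
  rw [ENNReal.toReal_mul, ENNReal.toReal_sum (by simp), ENNReal.toReal_natCast] at h1
  rw [inv_mul_le_iff₀ (by positivity)]
  have h2 : 0 ≤ ∑ l ∈ Finset.range M, (P x).real {ω | J (l • η) ω = x} :=
    Finset.sum_nonneg fun _ _ => measureReal_nonneg
  have h3 : (M : ℝ) ≤ (∑ l ∈ Finset.range M, (P x).real {ω | J (l • η) ω = x}) * C.toReal := h1
  linarith

/-- The tail formula for the mean: avoiding `x` at steps `1, …, j` means that the return time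
exceeds `j`. -/
theorem IsMarkovChain.sum_avoid_le_lintegral_returnTimeD {J : ℕ → Ω → V} (h : IsMarkovChain P J)
    (x : V) (M : ℕ) :
    ∑ j ∈ Finset.range M, P x {ω | ∀ i < j, J ((i + 1) • 1) ω ≠ x} ≤
      ∫⁻ ω, returnTimeD J x ω ∂(P x) := by
  classical
  have hm : ∀ j, MeasurableSet {ω | ∀ i < j, J ((i + 1) • 1) ω ≠ x} := fun j => by
    simp only [Set.ofPred_forall]
    exact MeasurableSet.iInter fun i => MeasurableSet.iInter fun _ => (h.measurableSet_eq _ _).compl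
  simp_rw [← fun j => lintegral_indicator_one (μ := P x) (hm j)]
  rw [← lintegral_finsetSum _ fun j _ => measurable_one.indicator (hm j)]
  refine lintegral_mono fun ω => ?_
  refine le_iInf₂ fun n hn => ?_
  calc ∑ j ∈ Finset.range M, Set.indicator {ω | ∀ i < j, J ((i + 1) • 1) ω ≠ x} 1 ω
      ≤ ∑ j ∈ Finset.range M, if j < n then (1 : ℝ≥0∞) else 0 := by
        refine Finset.sum_le_sum fun j _ => ?_
        rw [Set.indicator_apply]
        split_ifs with h1 h2 h2
        · exact le_rfl
        · exfalso
          refine h1 (n - 1) (by omega) ?_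
          rw [smul_eq_mul, mul_one, Nat.sub_add_cancel hn.1]
          exact hn.2
        · exact zero_le
        · exact le_rfl
    _ ≤ n := by
        rw [← Finset.sum_filter, Finset.sum_const, nsmul_eq_mul, mul_one]
        refine Nat.cast_le.2 ?_
        refine (Finset.card_le_card (t := Finset.range n) fun j hj => ?_).trans_eq
          (Finset.card_range n)
        exact Finset.mem_range.2 (Finset.mem_filter.1 hj).2

theorem IsMarkovChain.exists_frequency_of_isPosRecurrentD [Countable V] {J : ℕ → Ω → V}
    (h : IsMarkovChain P J) {x : V} (hx : IsPosRecurrentD P J x) :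
    ∃ c > 0, ∀ M : ℕ, c * M ≤ ∑ l ∈ Finset.range M, (P x).real {ω | J (l • 1) ω = x} :=
  frequency_of_le_mul h x 1 hx.ne fun M => (h.le_sum_visits_mul x 1 M).trans (by
    gcongr
    exact h.sum_avoid_le_lintegral_returnTimeD x M)

theorem IsNonexplosiveChain.sum_noDyadicReturn_le {J : ℝ≥0 → Ω → V} (h : IsNonexplosiveChain P J)
    (x : V) {η : ℝ≥0} (hη : 0 < η) (M : ℕ) :
    ∑ i ∈ Finset.range M, P x (noDyadicReturn J x η i) ≤
      1 + (∫⁻ ω, returnTimeC J x ω ∂(P x)) / η := by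
  classical
  have := h.isProbabilityMeasure x
  have hη' : (η : ℝ≥0∞) ≠ 0 := by exact_mod_cast hη.ne'
  have hm : ∀ i, MeasurableSet (noDyadicReturn J x η i) := fun i =>
    MeasurableSet.iInter fun m => h.measurableSet_noGridReturn x _ _
  simp_rw [← fun i => lintegral_indicator_one (μ := P x) (hm i)]
  rw [← lintegral_finsetSum _ fun i _ => measurable_one.indicator (hm i)]
  calc _ ≤ ∫⁻ ω, (1 + returnTimeC J x ω * (η : ℝ≥0∞)⁻¹) ∂(P x) := by
        refine lintegral_mono_ae ?_
        filter_upwards [h.step x] with ω hω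
        refine sum_range_le_one_add (fun i => ?_) (fun i hi => ?_) M
        · exact Set.indicator_le_self' (fun _ _ => zero_le) ω
        · have hmem := Set.mem_of_indicator_ne_zero hi
          rw [← div_eq_mul_inv, ENNReal.le_div_iff_mul_le (Or.inl hη') (Or.inl (by simp))]
          exact le_returnTimeC_of_mem_noDyadicReturn hη hω hmem
    _ = _ := by
        rw [lintegral_add_left measurable_const, lintegral_mul_const' _ _ (by simpa using hη'),
          div_eq_mul_inv]
        simp

theorem IsMarkovChain.sum_shift_le [AddCommMonoid T] {J : T → Ω → V} (h : IsMarkovChain P J)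
    (x : V) (η : T) (M : ℕ) :
    ∑ i ∈ Finset.range M, P x {ω | J ((i + 1) • η) ω = x} ≤
      ∑ i ∈ Finset.range M, P x {ω | J (i • η) ω = x} := by
  have := h.isProbabilityMeasure x
  rcases M with _ | M
  · simp
  rw [Finset.sum_range_succ, Finset.sum_range_succ' _ M]
  refine add_le_add le_rfl ?_
  rw [zero_smul, h.measure_zero_eq_self]
  exact prob_le_one

/-- On the grid of mesh `δ = η / n` both visits and avoidance must be compared with the scale `η`.
Visits number at most `n` times those at scale `η`, while an excursion starting at the first
`δ`-step carries a compensating factor `1 / n`. The resulting bound stays useful as the mesh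
shrinks. -/
theorem IsNonexplosiveChain.le_sum_visits_mul_dyadic [Countable V] {J : ℝ≥0 → Ω → V}
    (h : IsNonexplosiveChain P J) (x : V) {η : ℝ≥0}
    (hold : 2⁻¹ ≤ P x {ω | ∀ u ≤ η, J u ω = x}) (M m : ℕ) :
    (M : ℝ≥0∞) ≤ 2 * (∑ i ∈ Finset.range M, P x {ω | J (i • η) ω = x}) *
      (1 + 2 * ∑ i ∈ Finset.range M, P x (noGridReturn J x (η / 2 ^ m) (i * 2 ^ m))) := by
  have := h.isProbabilityMeasure x
  set n : ℕ := 2 ^ m with hn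
  set δ : ℝ≥0 := η / 2 ^ m with hδ
  have hn0 : (n : ℝ≥0∞) ≠ 0 := by simp [hn]
  have hnδ : n • δ = η := by
    rw [nsmul_eq_mul, hδ, hn]
    push_cast
    field_simp
  have hle : ∀ k ≤ n, k • δ ≤ η := fun k hk => hnδ ▸ nsmul_le_nsmul_left zero_le hk
  have hhalf : ∀ u ≤ η, 2⁻¹ ≤ P x {ω | J u ω = x} := fun u hu =>
    hold.trans (measure_mono fun ω (hω : ∀ u ≤ η, J u ω = x) => hω u hu)
  have visits : ∑ l ∈ Finset.range (M * n), P x {ω | J (l • δ) ω = x} ≤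
      n * ∑ i ∈ Finset.range M, 2 * P x {ω | J ((i + 1) • η) ω = x} := by
    -- From a visit inside a block, hold until the block ends at `(i + 1) • η`.
    refine sum_range_mul_le M fun i _ k hk => ?_
    refine le_two_mul_of_half_le (hhalf ((n - k) • δ) (hle _ (Nat.sub_le _ _))) ?_
    have := h.measure_mul_le x x ((i * n + k) • δ) ((n - k) • δ)
    rwa [← add_smul, show i * n + k + (n - k) = (i + 1) * n by
      rw [add_assoc, Nat.add_sub_cancel' hk.le, Nat.succ_mul], mul_smul, hnδ] at this
  have avoid : n * ∑ j ∈ Finset.range (M * n), P x {ω | ∀ i < j, J ((i + 1) • δ) ω ≠ x} ≤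
      n * (1 + 2 * ∑ i ∈ Finset.range M, P x (noGridReturn J x δ (i * n))) := by
    have e1 : ∀ j, 0 < j → n * P x {ω | ∀ i < j, J ((i + 1) • δ) ω ≠ x} ≤
        2 * P x (noGridReturn J x δ j) := fun j hj => by
      have h1 := h.mul_measure_excursion_le x δ n j hj
      rw [mul_comm (P x _), ← mul_assoc] at h1
      refine le_two_mul_of_half_le (hold.trans (measure_mono ?_)) h1
      exact fun ω hω i hi => hω _ (hle i hi.le)
    have e2 : ∑ j ∈ Finset.range (M * n), P x (noGridReturn J x δ j) ≤
        n * ∑ i ∈ Finset.range M, P x (noGridReturn J x δ (i * n)) :=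
      sum_range_mul_le M fun i _ k _ =>
        measure_mono (noGridReturn_antitone J x δ (Nat.le_add_right _ _))
    -- The excursion bound needs `j > 0`; the term `j = 0` contributes the extra `n`.
    have e3 : ∀ N, ∑ j ∈ Finset.range N, n * P x {ω | ∀ i < j, J ((i + 1) • δ) ω ≠ x} ≤
        n + ∑ j ∈ Finset.range N, 2 * P x (noGridReturn J x δ j) := by
      intro N
      rcases N with _ | N
      · simp
      rw [Finset.sum_range_succ', Finset.sum_range_succ', add_comm]
      refine add_le_add ?_ (le_add_right (Finset.sum_le_sum fun j _ => e1 _ (Nat.succ_pos j)))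
      exact (mul_le_mul_right prob_le_one _).trans_eq (mul_one _)
    rw [Finset.mul_sum]
    refine (e3 _).trans ?_
    rw [← Finset.mul_sum, mul_add, mul_one, mul_left_comm]
    gcongr
  have key := h.le_sum_visits_mul x δ (M * n)
  have hfin : (n : ℝ≥0∞) ≠ ∞ := by simp
  have avoid' := (ENNReal.mul_le_mul_iff_right hn0 hfin).1 avoid
  refine (ENNReal.mul_le_mul_iff_right hn0 hfin).1 ?_
  calc (n : ℝ≥0∞) * M = (M * n : ℕ) := by push_cast; ring
    _ ≤ _ := key
    _ ≤ (n * ∑ i ∈ Finset.range M, 2 * P x {ω | J ((i + 1) • η) ω = x}) *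
        (1 + 2 * ∑ i ∈ Finset.range M, P x (noGridReturn J x δ (i * n))) :=
      mul_le_mul' visits avoid'
    _ ≤ _ := by
      rw [mul_assoc, ← Finset.mul_sum]
      refine mul_le_mul' le_rfl (mul_le_mul' (mul_le_mul' le_rfl ?_) le_rfl)
      exact h.sum_shift_le x η M

theorem IsNonexplosiveChain.exists_frequency_of_lintegral_lt_top [Countable V] {J : ℝ≥0 → Ω → V}
    (h : IsNonexplosiveChain P J) {x : V} (hx : ∫⁻ ω, returnTimeC J x ω ∂(P x) < ∞) {η : ℝ≥0}
    (hη : 0 < η) (hold : 2⁻¹ ≤ P x {ω | ∀ u ≤ η, J u ω = x}) :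
    ∃ c > 0, ∀ M : ℕ, c * M ≤ ∑ l ∈ Finset.range M, (P x).real {ω | J (l • η) ω = x} := by
  have := h.isProbabilityMeasure x
  have hη' : (η : ℝ≥0∞) ≠ 0 := by exact_mod_cast hη.ne'
  refine frequency_of_le_mul h.toIsMarkovChain x η
    (C := 2 * (1 + 2 * (1 + (∫⁻ ω, returnTimeC J x ω ∂(P x)) / η))) ?_ fun M => ?_
  · have := (ENNReal.div_lt_top hx.ne hη').ne
    finiteness
  -- Refine the mesh with `M` fixed: the no-return events decrease to the dyadic ones, whose total
  -- probability is controlled by the mean return time.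
  have hlim : Tendsto (fun m : ℕ => 2 * (∑ i ∈ Finset.range M, P x {ω | J (i • η) ω = x}) *
      (1 + 2 * ∑ i ∈ Finset.range M, P x (noGridReturn J x (η / 2 ^ m) (i * 2 ^ m)))) atTop
      (𝓝 (2 * (∑ i ∈ Finset.range M, P x {ω | J (i • η) ω = x}) *
      (1 + 2 * ∑ i ∈ Finset.range M, P x (noDyadicReturn J x η i)))) := by
    refine ENNReal.Tendsto.const_mul ?_ (Or.inr (ENNReal.mul_ne_top (by simp)
      (by simp)))
    refine tendsto_const_nhds.add (ENNReal.Tendsto.const_mul ?_ (Or.inr (by simp)))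
    refine tendsto_finsetSum _ fun i _ => ?_
    exact tendsto_measure_iInter_atTop
      (fun m => (h.measurableSet_noGridReturn x _ _).nullMeasurableSet)
      (antitone_noGridReturn_dyadic J x η i) ⟨0, measure_ne_top _ _⟩
  calc (M : ℝ≥0∞) ≤ 2 * (∑ i ∈ Finset.range M, P x {ω | J (i • η) ω = x}) *
      (1 + 2 * ∑ i ∈ Finset.range M, P x (noDyadicReturn J x η i)) :=
        ge_of_tendsto' hlim fun m => h.le_sum_visits_mul_dyadic x hold M m
    _ ≤ 2 * (∑ i ∈ Finset.range M, P x {ω | J (i • η) ω = x}) *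
      (1 + 2 * (1 + (∫⁻ ω, returnTimeC J x ω ∂(P x)) / η)) := by
        gcongr
        exact h.sum_noDyadicReturn_le x hη M
    _ = _ := by ring

end Frequency

/-! ### Block counts and divergence of the return sums -/

/-- Once `1 ≤ a n * t`, the inner floor is at least `a n * t / 2`; without this it could stay 0. -/
theorem tendsto_blockCount_atTop {a θ : ℕ → ℝ} (ha : ∀ n, 0 < a n) (hθ : ∀ n, 0 < θ n)
    (hθa : θ =o[atTop] a) {t : ℝ} (ht : 0 < t) (h1 : ∀ᶠ n in atTop, 1 ≤ a n * t) :
    Tendsto (fun n => blockCount a θ n t) atTop atTop := by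
  refine tendsto_atTop.2 fun C => ?_
  filter_upwards [h1, hθa.bound (show 0 < t / (2 * (C + 1)) by positivity)] with n hn1 hn2
  rw [Real.norm_of_nonneg (hθ n).le, Real.norm_of_nonneg (ha n).le, div_mul_eq_mul_div,
    le_div_iff₀ (by positivity)] at hn2
  refine Nat.le_floor ?_
  rw [le_div_iff₀ (hθ n)]
  have h2 := Nat.lt_floor_add_one (a n * t)
  have h3 : (1 : ℝ) ≤ ⌊a n * t⌋₊ := by exact_mod_cast Nat.le_floor (by simpa using hn1)
  have h4 := hθ n
  nlinarith

section VisitSums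

variable {T V Ω : Type*} [AddCommMonoid T] [MeasurableSpace Ω] {P : V → Measure Ω} {J : T → Ω → V}

theorem not_returnCond_of_tendsto_atTop {θ : ℕ → T} {k : ℕ → ℝ → ℕ} {t : ℝ} {x : V}
    (h : Tendsto (fun n => visitSum (P x) J (θ n) (k n t) x) atTop atTop) (c : ℝ) :
    ¬ ReturnCond P J θ k t c x := fun ⟨l, _, hl⟩ => not_tendsto_nhds_of_tendsto_atTop h l hl

theorem sum_range_le_one_add_visitSum (h : IsMarkovChain P J) (x : V) (θ : T) (K : ℕ) :
    ∑ j ∈ Finset.range K, (P x).real {ω | J (j • θ) ω = x} ≤ 1 + visitSum (P x) J θ K x := by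
  have := h.isProbabilityMeasure x
  rcases K with _ | K
  · simp [visitSum]
  rw [Finset.range_eq_Ico, Finset.sum_eq_sum_Ico_succ_bot (Nat.succ_pos K)]
  exact add_le_add measureReal_le_one le_rfl

theorem tendsto_visitSum_atTop_of_linear_growth (h : IsMarkovChain P J) {x : V} {c : ℝ}
    (hc : 0 < c) (hgrowth : ∀ (θ : T) (K : ℕ),
      c * K ≤ 2 * ∑ j ∈ Finset.range K, (P x).real {ω | J (j • θ) ω = x})
    (θ : ℕ → T) {K : ℕ → ℕ} (hK : Tendsto K atTop atTop) :
    Tendsto (fun n => visitSum (P x) J (θ n) (K n) x) atTop atTop := by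
  have h1 : Tendsto (fun n => c / 2 * (K n : ℝ) - 1) atTop atTop :=
    tendsto_atTop_add_const_right _ _
      ((tendsto_natCast_atTop_atTop.comp hK).const_mul_atTop (by positivity))
  refine tendsto_atTop_mono (fun n => ?_) h1
  have h2 := hgrowth (θ n) (K n)
  have h3 := sum_range_le_one_add_visitSum h x (θ n) (K n)
  linarith

/-- Under `π` the expected number of visits in `K` steps is exactly `π x * K`, and it is an average
over starting points of quantities maximal at `x`. -/
theorem IsMarkovChain.exists_linear_growth_of_isInvariantLaw [Countable V]
    (h : IsMarkovChain P J) {π : PMF V} (hπ : IsInvariantLaw P J π) :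
    ∃ x : V, ∃ c > 0, ∀ (θ : T) (K : ℕ),
      c * K ≤ 2 * ∑ j ∈ Finset.range K, (P x).real {ω | J (j • θ) ω = x} := by
  obtain ⟨x, hx⟩ := π.support_nonempty
  have := h.isProbabilityMeasure x
  have hx0 : π x ≠ 0 := (π.mem_support_iff x).1 hx
  refine ⟨x, (π x).toReal, ENNReal.toReal_pos hx0 (π.apply_ne_top x), fun θ K => ?_⟩
  have h1 : π x * K ≤ ∑ j ∈ Finset.range K, P x {ω | J (j • θ) ω = x} := by
    calc π x * K = ∑ j ∈ Finset.range K, ∑' y, π y * P y {ω | J (j • θ) ω = x} := by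
          simp [hπ _ x, mul_comm]
      _ = ∑' y, π y * ∑ j ∈ Finset.range K, P y {ω | J (j • θ) ω = x} := by
          rw [← Summable.tsum_finsetSum fun _ _ => ENNReal.summable]
          simp_rw [Finset.mul_sum]
      _ ≤ ∑' y, π y * ∑ j ∈ Finset.range K, P x {ω | J (j • θ) ω = x} := by
          refine ENNReal.tsum_le_tsum fun y => ?_
          refine mul_le_mul' le_rfl ?_
          simpa using h.sum_measure_le y x 0 θ K
      _ = _ := by rw [ENNReal.tsum_mul_right, π.tsum_coe, one_mul]
  have h2 := ENNReal.toReal_mono (by simp) h1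
  rw [ENNReal.toReal_mul, ENNReal.toReal_natCast, ENNReal.toReal_sum (by simp)] at h2
  have h3 : 0 ≤ ∑ j ∈ Finset.range K, (P x).real {ω | J (j • θ) ω = x} :=
    Finset.sum_nonneg fun _ _ => measureReal_nonneg
  change _ ≤ ∑ j ∈ Finset.range K, (P x).real {ω | J (j • θ) ω = x} at h2
  linarith

end VisitSums

/-! ### Linear growth at positive recurrent states -/

section PositiveRecurrence

variable {V Ω : Type*} [Countable V] [MeasurableSpace Ω] {P : V → Measure Ω}

theorem IsMarkovChain.exists_linear_growth_of_isPosRecurrentD {J : ℕ → Ω → V}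
    (h : IsMarkovChain P J) {x : V} (hx : IsPosRecurrentD P J x) :
    ∃ c > 0, ∀ θ K : ℕ,
      c * K ≤ 2 * ∑ j ∈ Finset.range K, (P x).real {ω | J (j • θ) ω = x} := by
  obtain ⟨c, hc, hfreq⟩ := h.exists_frequency_of_isPosRecurrentD hx
  refine ⟨c, hc, h.mul_le_two_mul_sum_of_frequency x 1 hfreq fun t => ⟨t, fun l => ?_⟩⟩
  have e : (t + l) • 1 = l • 1 + t := by simp [add_comm]
  rw [e]
  have : 0 ≤ (P x).real {ω | J (l • 1 + t) ω = x} := measureReal_nonneg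
  linarith

theorem IsNonexplosiveChain.exists_linear_growth_of_isPosRecurrentC {J : ℝ≥0 → Ω → V}
    (h : IsNonexplosiveChain P J) {x : V} (hx : IsPosRecurrentC P J x) :
    ∃ c > 0, ∀ (θ : ℝ≥0) (K : ℕ),
      c * K ≤ 2 * ∑ j ∈ Finset.range K, (P x).real {ω | J (j • θ) ω = x} := by
  have := h.isProbabilityMeasure x
  rcases hx with habs | hx
  · refine ⟨1, one_pos, fun θ K => ?_⟩
    have h1 : ∀ t, (P x).real {ω | J t ω = x} = 1 := fun t => by
      have : P x {ω | J t ω = x} = 1 := by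
        rw [← measure_univ (μ := P x)]
        refine measure_congr ?_
        filter_upwards [habs] with ω hω
        exact propext ⟨fun _ => trivial, fun _ => hω t⟩
      rw [measureReal_def, this, ENNReal.toReal_one]
    have : (0 : ℝ) ≤ K := Nat.cast_nonneg K
    simp only [h1, Finset.sum_const, Finset.card_range, nsmul_eq_mul, mul_one]
    linarith
  · obtain ⟨η, hη, hold⟩ := h.exists_holding x
    obtain ⟨c, hc, hfreq⟩ := h.exists_frequency_of_lintegral_lt_top hx hη hold
    -- Round `t` down to the `η`-grid; holding over the remainder, at most `η`, costs the factor 2.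
    refine ⟨c, hc, h.mul_le_two_mul_sum_of_frequency x η hfreq fun t => ⟨⌊t / η⌋₊, fun l => ?_⟩⟩
    have h1 : ⌊t / η⌋₊ • η ≤ t := by
      rw [nsmul_eq_mul, ← le_div_iff₀ hη]
      exact Nat.floor_le zero_le
    have h2 : t ≤ ⌊t / η⌋₊ • η + η := by
      calc t = t / η * η := (div_mul_cancel₀ _ hη.ne').symm
        _ ≤ (⌊t / η⌋₊ + 1) * η := by
          gcongr
          exact (Nat.lt_floor_add_one _).le
        _ = _ := by rw [add_mul, one_mul, nsmul_eq_mul]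
    have h3 := h.measure_mul_le x x ((⌊t / η⌋₊ + l) • η) (t - ⌊t / η⌋₊ • η)
    rw [add_comm ⌊t / η⌋₊ l, add_smul, add_assoc, add_tsub_cancel_of_le h1, ← add_smul] at h3
    have h4 := ENNReal.toReal_mono (ENNReal.mul_ne_top (by simp) (measure_ne_top _ _))
      (le_two_mul_of_half_le (hold.trans
        (measure_mono fun ω (hω : ∀ u ≤ η, J u ω = x) => hω _ (tsub_le_iff_left.2 h2))) h3)
    rw [ENNReal.toReal_mul] at h4
    rw [add_comm ⌊t / η⌋₊ l]
    exact h4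

end PositiveRecurrence

end BlockedChain



theorem lemma1p2 {V Ω : Type*} [Countable V] [MeasurableSpace Ω]
    (P : V → Measure Ω) (μ : PMF V) (a : ℕ → ℝ) (ha_pos : ∀ n, 0 < a n) (ha_mono : Monotone a) :
    -- discrete time
    (∀ (J : ℕ → Ω → V) (θ : ℕ → ℕ), IsMarkovChain P J → (∀ n, 0 < θ n) →
      (Tendsto θ atTop atTop → ∀ t > 0, ∃ c : ℝ, ∀ x, IsTransient P J x →
        OccupationCond P μ J θ (blockCount a fun n => (θ n : ℝ)) t x ∧
        ReturnCond P J θ (blockCount a fun n => (θ n : ℝ)) t c x) ∧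
      ((fun n => (θ n : ℝ)) =o[atTop] a →
        (∀ x, IsPosRecurrentD P J x → ∀ t > 0,
          Tendsto (fun n => visitSum (P x) J (θ n) (blockCount a (fun m => (θ m : ℝ)) n t) x)
            atTop atTop ∧
          ∀ c : ℝ, ¬ ReturnCond P J θ (blockCount a fun n => (θ n : ℝ)) t c x) ∧
        ((∃ π : PMF V, IsInvariantLaw P J π) →
          ¬ CondA1 P μ J θ (blockCount a fun n => (θ n : ℝ))))) ∧
    -- continuous time
    (∀ (J : ℝ≥0 → Ω → V) (θ : ℕ → ℝ≥0), IsNonexplosiveChain P J → (∀ n, 0 < θ n) →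
      (Tendsto θ atTop atTop → ∀ t > 0, ∃ c : ℝ, ∀ x, IsTransient P J x →
        OccupationCond P μ J θ (blockCount a fun n => (θ n : ℝ)) t x ∧
        ReturnCond P J θ (blockCount a fun n => (θ n : ℝ)) t c x) ∧
      ((fun n => (θ n : ℝ)) =o[atTop] a →
        (∀ x, IsPosRecurrentC P J x → ∀ t > 0, (∀ᶠ n in atTop, 1 ≤ a n * t) →
          Tendsto (fun n => visitSum (P x) J (θ n) (blockCount a (fun m => (θ m : ℝ)) n t) x)
            atTop atTop ∧
          ∀ c : ℝ, ¬ ReturnCond P J θ (blockCount a fun n => (θ n : ℝ)) t c x) ∧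
        ((∃ π : PMF V, IsInvariantLaw P J π) →
          ¬ CondA1 P μ J θ (blockCount a fun n => (θ n : ℝ))))) := by
  refine ⟨fun J θ h hθ => ⟨fun hθ' t _ => ⟨1, fun x hx => ⟨?_, 0, one_pos, ?_⟩⟩, fun hθa => ?_⟩,
    fun J θ h hθ => ⟨fun hθ' t _ => ⟨1, fun x hx => ⟨?_, 0, one_pos, ?_⟩⟩, fun hθa => ?_⟩⟩
  · exact h.tendsto_visitSum_of_isTransient μ hx hθ' _
  · simp_rw [visitSum_initLaw_pure h]
    exact h.tendsto_visitSum_of_isTransient _ hx hθ' _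
  · have hθ0 : ∀ n, (0 : ℝ) < θ n := fun n => Nat.cast_pos.2 (hθ n)
    have hcount : ∀ t > 0, Tendsto (fun n => blockCount a (fun m => (θ m : ℝ)) n t) atTop atTop := by
      intro t ht
      refine tendsto_blockCount_atTop ha_pos hθ0 hθa ht ?_
      -- In discrete time `1 ≤ θ n`, and eventually `θ n ≤ t * a n`.
      filter_upwards [hθa.bound ht] with n hn
      rw [Real.norm_of_nonneg (hθ0 n).le, Real.norm_of_nonneg (ha_pos n).le, mul_comm] at hn
      exact le_trans (by exact_mod_cast hθ n) hn
    refine ⟨fun x hx t ht => ?_, fun ⟨π, hπ⟩ hA => ?_⟩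
    · obtain ⟨c, hc, hgrowth⟩ := h.exists_linear_growth_of_isPosRecurrentD hx
      have := tendsto_visitSum_atTop_of_linear_growth h hc hgrowth θ (hcount t ht)
      exact ⟨this, not_returnCond_of_tendsto_atTop this⟩
    · obtain ⟨x, c, hc, hgrowth⟩ := h.exists_linear_growth_of_isInvariantLaw hπ
      obtain ⟨C, -, hC⟩ := hA 1 one_pos
      exact not_returnCond_of_tendsto_atTop (tendsto_visitSum_atTop_of_linear_growth h hc hgrowth θ
        (hcount 1 one_pos)) C (hC x)
  · exact h.tendsto_visitSum_of_isTransient μ hx hθ' _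
  · simp_rw [visitSum_initLaw_pure h.toIsMarkovChain]
    exact h.tendsto_visitSum_of_isTransient _ hx hθ' _
  · have hθ0 : ∀ n, (0 : ℝ) < θ n := fun n => NNReal.coe_pos.2 (hθ n)
    refine ⟨fun x hx t ht h1 => ?_, fun ⟨π, hπ⟩ hA => ?_⟩
    · obtain ⟨c, hc, hgrowth⟩ := h.exists_linear_growth_of_isPosRecurrentC hx
      have := tendsto_visitSum_atTop_of_linear_growth h.toIsMarkovChain hc hgrowth θ
        (tendsto_blockCount_atTop ha_pos hθ0 hθa ht h1)
      exact ⟨this, not_returnCond_of_tendsto_atTop this⟩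
    · obtain ⟨x, c, hc, hgrowth⟩ := h.exists_linear_growth_of_isInvariantLaw hπ
      -- Since `a` may stay bounded, `t` is chosen so that monotonicity gives `a n * t ≥ 1` for all
      -- `n`.
      have ht : 0 < (a 0)⁻¹ := inv_pos.2 (ha_pos 0)
      obtain ⟨C, -, hC⟩ := hA (a 0)⁻¹ ht
      have h1 : ∀ᶠ n in atTop, 1 ≤ a n * (a 0)⁻¹ := Eventually.of_forall fun n => by
        rw [← div_eq_mul_inv, one_le_div (ha_pos 0)]
        exact ha_mono (Nat.zero_le n)
      exact not_returnCond_of_tendsto_atTop (tendsto_visitSum_atTop_of_linear_growth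
        h.toIsMarkovChain hc hgrowth θ (tendsto_blockCount_atTop ha_pos hθ0 hθa ht h1)) C (hC x)
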